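/- Let $N \ge 3$ and let $F_N$ be the free group of rank $N$. Let $cv_N$ be the (unprojectivized) Culler–Vogtmann outer space, i.e. the set of free, minimal, discrete, isometric actions of $F_N$ on $\mathbb{R}$-trees, where two trees are identified if there is an $F_N$-equivariant isometry between them. For $T \in cv_N$ and $g \in F_N$ let $\|g\|_T = \inf_{x \in T} d(x, gx)$ be the translation length. A subset $\Sigma \subseteq F_N$ is spectrally rigid if, whenever $T_1, T_2 \in cv_N$ satisfy $\|\sigma\|_{T_1} = \|\sigma\|_{T_2}$ for all $\sigma \in \Sigma$, then $T_1 = T_2$ in $cv_N$. A subset $\Sigma \subseteq F_N$ has property $\mathcal{W}$ if there exist a free basis $\mathcal{A}$ of $F_N$, an element $a \in \mathcal{A}$ and an integer $M \ge 1$ such that for every $\sigma \in \Sigma$ and every $k \in \mathbb{Z}$: if $a^k$ is a subword of the cyclic word $[[\sigma]]_{\mathcal{A}}$ (the cyclically reduced form of $\sigma$ over $\mathcal{A}$, up to cyclic permutation; that is, $a^k$ is a block of consecutive letters in some cyclic permutation of that form), then $|k| \le M$. If $\Sigma \subseteq F_N$ has property $\mathcal{W}$, then $\Sigma$ is not spectrally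 rigid. -/

import Mathlib

/-- An `ℝ`-tree: a nonempty geodesic metric space that is `0`-hyperbolic (four-point condition). -/
structure IsRTree (X : Type*) [MetricSpace X] : Prop where
  nonempty : Nonempty X
  geodesic : ∀ x y : X, ∃ γ : ℝ → X, γ 0 = x ∧ γ (dist x y) = y ∧
    ∀ s ∈ Set.Icc 0 (dist x y), ∀ t ∈ Set.Icc 0 (dist x y), dist (γ s) (γ t) = |s - t|
  four_point : ∀ x y z w : X,
    dist x y + dist z w ≤ max (dist x z + dist y w) (dist x w + dist y z)

/-- A free, minimal, discrete, isometric action of the free group `F_N` on an `ℝ`-tree. -/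
structure FreeGroupTree (N : ℕ) where
  carrier : Type
  [metric : MetricSpace carrier]
  [action : MulAction (FreeGroup (Fin N)) carrier]
  isRTree : IsRTree carrier
  isometric : ∀ (g : FreeGroup (Fin N)) (x y : carrier), dist (g • x) (g • y) = dist x y
  free : ∀ (g : FreeGroup (Fin N)) (x : carrier), g • x = x → g = 1
  /-- There is no proper invariant subtree; a subtree is a subset that is an `ℝ`-tree for the
  restricted metric. -/
  minimal : ∀ S : Set carrier, (∀ g : FreeGroup (Fin N), ∀ x ∈ S, g • x ∈ S) →
    IsRTree S → S = Set.univ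
  /-- Every orbit is a discrete subset. -/
  discrete : ∀ x : carrier, DiscreteTopology (MulAction.orbit (FreeGroup (Fin N)) x)

namespace FreeGroupTree

attribute [instance] metric action

/-- Two trees are equivalent if there is an `F_N`-equivariant isometry between them. -/
def Equivalent {N : ℕ} (T₁ T₂ : FreeGroupTree N) : Prop :=
  ∃ f : T₁.carrier ≃ᵢ T₂.carrier, ∀ (g : FreeGroup (Fin N)) (x : T₁.carrier),
    f (g • x) = g • f x

instance setoid (N : ℕ) : Setoid (FreeGroupTree N) where
  r := Equivalent
  iseqv :=
    { refl := fun T => ⟨IsometryEquiv.refl _, fun _ _ => rfl⟩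
      symm := by
        rintro T₁ T₂ ⟨f, hf⟩
        refine ⟨f.symm, fun g x => f.injective ?_⟩
        rw [hf, f.apply_symm_apply, f.apply_symm_apply]
      trans := by
        rintro T₁ T₂ T₃ ⟨f, hf⟩ ⟨h, hh⟩
        refine ⟨f.trans h, fun g x => ?_⟩
        simp only [IsometryEquiv.trans_apply, hf, hh] }

/-- The translation length `inf {d(x, g x) : x ∈ T}`. -/
noncomputable def translationLength {N : ℕ} (T : FreeGroupTree N) (g : FreeGroup (Fin N)) : ℝ :=
  ⨅ x : T.carrier, dist x (g • x)

theorem Equivalent.translationLength_eq {N : ℕ} {T₁ T₂ : FreeGroupTree N}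
    (h : Equivalent T₁ T₂) : T₁.translationLength = T₂.translationLength := by
  obtain ⟨f, hf⟩ := h
  funext g
  refine Equiv.iInf_congr f.toEquiv fun x => ?_
  have := f.dist_eq x (g • x)
  rw [hf] at this
  exact this

end FreeGroupTree

/-- (Unprojectivized) Culler–Vogtmann outer space `cv_N`. -/
def OuterSpace (N : ℕ) : Type 1 := Quotient (FreeGroupTree.setoid N)

/-- The translation length function of a point of outer space. -/
noncomputable def OuterSpace.translationLength {N : ℕ} (T : OuterSpace N) :
    FreeGroup (Fin N) → ℝ :=
  Quotient.lift FreeGroupTree.translationLength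
    (fun _ _ h => FreeGroupTree.Equivalent.translationLength_eq h) T

/-- `S ⊆ F_N` is spectrally rigid if points of `cv_N` are determined by the translation lengths
of the elements of `S`. -/
def SpectrallyRigid {N : ℕ} (S : Set (FreeGroup (Fin N))) : Prop :=
  ∀ T₁ T₂ : OuterSpace N,
    (∀ g ∈ S, T₁.translationLength g = T₂.translationLength g) → T₁ = T₂

/-- The cyclic word `[[g]]_A` given by the cyclically reduced form of `g` over the free
basis `A`. -/
def cyclicWord {N : ℕ} (A : FreeGroupBasis (Fin N) (FreeGroup (Fin N)))
    (g : FreeGroup (Fin N)) : Cycle (Fin N × Bool) :=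
  (FreeGroup.reduceCyclically (A.repr g).toWord : Cycle (Fin N × Bool))

/-- `w` is a subword of the cyclic word `c`: a block of consecutive letters of one of the linear
words representing `c` (so `w` is no longer than `c`). -/
def IsCyclicSubword {α : Type*} (w : List α) (c : Cycle α) : Prop :=
  ∃ l : List α, (l : Cycle α) = c ∧ w <:+: l

/-- Property `W`: for some free basis `A`, some `a = A i` in it and some `M ≥ 1`, every power
`a ^ k` that is a subword of the cyclic word `[[σ]]_A` of some `σ ∈ S` has `|k| ≤ M`. -/
def PropertyW {N : ℕ} (S : Set (FreeGroup (Fin N))) : Prop :=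
  ∃ (A : FreeGroupBasis (Fin N) (FreeGroup (Fin N))) (i : Fin N) (M : ℕ), 1 ≤ M ∧
    ∀ σ ∈ S, ∀ k : ℤ, IsCyclicSubword (A.repr (A i ^ k)).toWord (cyclicWord A σ) → |k| ≤ (M : ℤ)

/-! Let `a = A i` be the letter whose powers are bounded by `M`, and pick two further basis letters
`j` and `c`; here `N ≥ 3` is used. Take a rose whose petals have length `1`, except that the petal
of `j` is replaced by a stick `s` of length `p` ending in a loop of length `q`. Mark it by the
homomorphism `twist`, which sends `j` to `i ^ L * s * j * s⁻¹` and fixes the other letters.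

If a reduced word has no run of `i` or `i⁻¹` of length `L` or more, no stick cancels in its image:
between consecutive occurrences of `j ^ ±1` the power of `i` created by `twist` is either still
nontrivial, or trivial only where the original word was not reduced (`IsReduced.cons_twistWord`).
Each occurrence of `j ^ ±1` then contributes exactly `2 * p + q`, so the length depends on `p` and
`q` only through this sum (`weightedNorm_twist_eq`). With `L = 2 * M + 1` this applies to the
cyclically reduced form of every `σ ∈ S` and to its square. But `i ^ (-L) * j` maps to `s * j *
s⁻¹`, of translation length `q`. The pairs `(1, 3)` and `(2, 1)` have the same sum and different
`q`, hence give different points of outer space that agree on `S`.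

The trees are built from length functions: a weighted word length pulled back along `twist` is
`0`-hyperbolic, `TreeHull` fills in the segments, and the translation length of `g` is `max 0 (ℓ (g
* g) - ℓ g)` (`TreeHull.iInf_dist_smul`). -/

/-! ### The `ℝ`-tree spanned by a `0`-hyperbolic pseudometric. -/

/-- A `0`-hyperbolic pseudometric, given as a function. -/
structure IsZeroHyperbolic {X : Type*} (d : X → X → ℝ) : Prop where
  self : ∀ x, d x x = 0
  symm : ∀ x y, d x y = d y x
  four_point : ∀ x y z w, d x y + d z w ≤ max (d x z + d y w) (d x w + d y z)

namespace IsZeroHyperbolic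

variable {X : Type*} {d : X → X → ℝ}

theorem triangle (hd : IsZeroHyperbolic d) (x y z : X) : d x z ≤ d x y + d y z := by
  have h := hd.four_point x z y y
  rw [hd.self, hd.symm z y, max_self] at h
  linarith

theorem nonneg (hd : IsZeroHyperbolic d) (x y : X) : 0 ≤ d x y := by
  have h := hd.triangle x y x
  rw [hd.self, hd.symm y x] at h
  linarith

end IsZeroHyperbolic

/-- The function `x ↦ dist p x`, where `p` is the point at distance `t` from `u` on the segment
from `u` to `v`. -/
def segmentPoint {X : Type*} (d : X → X → ℝ) (u v : X) (t : ℝ) (x : X) : ℝ :=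
  max (d x u - t) (d x v - (d u v - t))

/-- The `ℝ`-tree spanned by a `0`-hyperbolic space: the union of all segments between its points,
each point being represented by its distance function. -/
structure TreeHull {X : Type*} {d : X → X → ℝ} (hd : IsZeroHyperbolic d) where
  toFun : X → ℝ
  exists_eq : ∃ u v t, 0 ≤ t ∧ t ≤ d u v ∧ toFun = segmentPoint d u v t

namespace TreeHull

variable {X : Type*} {d : X → X → ℝ} {hd : IsZeroHyperbolic d}

instance : CoeFun (TreeHull hd) (fun _ => X → ℝ) := ⟨toFun⟩

theorem ext {p q : TreeHull hd} (h : ∀ x, p x = q x) : p = q := by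
  cases p; cases q; congr; exact funext h

/-- The point at distance `t` from `u` on the segment from `u` to `v`. -/
def seg (hd : IsZeroHyperbolic d) (u v : X) (t : ℝ) (h₀ : 0 ≤ t) (h₁ : t ≤ d u v) : TreeHull hd :=
  ⟨segmentPoint d u v t, u, v, t, h₀, h₁, rfl⟩

theorem seg_apply (u v : X) (t : ℝ) (h₀ : 0 ≤ t) (h₁ : t ≤ d u v) (x : X) :
    seg hd u v t h₀ h₁ x = max (d x u - t) (d x v - (d u v - t)) := rfl

theorem exists_eq_seg (p : TreeHull hd) : ∃ u v t h₀ h₁, p = seg hd u v t h₀ h₁ := by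
  obtain ⟨f, u, v, t, h₀, h₁, rfl⟩ := p
  exact ⟨u, v, t, h₀, h₁, rfl⟩

theorem seg_left (u v : X) (t : ℝ) (h₀ : 0 ≤ t) (h₁ : t ≤ d u v) : seg hd u v t h₀ h₁ u = t := by
  rw [seg_apply, hd.self, max_eq_right] <;> linarith

theorem seg_right (u v : X) (t : ℝ) (h₀ : 0 ≤ t) (h₁ : t ≤ d u v) :
    seg hd u v t h₀ h₁ v = d u v - t := by
  rw [seg_apply, hd.self, hd.symm v u, max_eq_left]; linarith

theorem le_add (p : TreeHull hd) (x y : X) : d x y ≤ p x + p y := by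
  obtain ⟨u, v, t, h₀, h₁, rfl⟩ := p.exists_eq_seg
  simp only [seg_apply]
  have h1 := le_max_left (d x u - t) (d x v - (d u v - t))
  have h2 := le_max_right (d x u - t) (d x v - (d u v - t))
  have h3 := le_max_left (d y u - t) (d y v - (d u v - t))
  have h4 := le_max_right (d y u - t) (d y v - (d u v - t))
  rcases le_max_iff.1 (hd.four_point x y u v) with h | h <;> linarith

theorem four_point_one (p : TreeHull hd) (x y z : X) :
    p x + d y z ≤ max (p y + d x z) (p z + d x y) := by
  obtain ⟨u, v, t, h₀, h₁, rfl⟩ := p.exists_eq_seg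
  simp only [seg_apply]
  have h1 := le_max_left (d y u - t) (d y v - (d u v - t))
  have h2 := le_max_right (d y u - t) (d y v - (d u v - t))
  have h3 := le_max_left (d z u - t) (d z v - (d u v - t))
  have h4 := le_max_right (d z u - t) (d z v - (d u v - t))
  rw [le_max_iff]
  rcases max_cases (d x u - t) (d x v - (d u v - t)) with ⟨h, -⟩ | ⟨h, -⟩ <;> rw [h]
  · have := le_max_iff.1 (hd.four_point x u y z)
    rw [hd.symm u y, hd.symm u z] at this
    rcases this with h | h
    · right; linarith
    · left; linarith
  · have := le_max_iff.1 (hd.four_point x v y z)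
    rw [hd.symm v y, hd.symm v z] at this
    rcases this with h | h
    · right; linarith
    · left; linarith

/-- The lower bound is the triangle inequality and the upper one the four-point condition. Hence the
supremum defining the distance to a point of `[u, v]` is attained at `u` or `v`, and `dist_seg` has
the same shape as `segmentPoint`. -/
theorem abs_sub_le (p : TreeHull hd) (u v : X) (t : ℝ) (h₀ : 0 ≤ t) (h₁ : t ≤ d u v) (x : X) :
    |p x - seg hd u v t h₀ h₁ x| ≤ max (p u - t) (p v - (d u v - t)) := by
  have h1 := le_max_left (p u - t) (p v - (d u v - t))
  have h2 := le_max_right (p u - t) (p v - (d u v - t))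
  rw [seg_apply]
  have h3 := le_max_left (d x u - t) (d x v - (d u v - t))
  have h4 := le_max_right (d x u - t) (d x v - (d u v - t))
  have h5 := p.le_add x u
  have h6 := p.le_add x v
  rw [abs_le]
  constructor
  · rcases max_cases (d x u - t) (d x v - (d u v - t)) with ⟨h, -⟩ | ⟨h, -⟩ <;> rw [h] <;> linarith
  · rcases le_max_iff.1 (p.four_point_one x u v) with h | h <;> linarith

theorem bddAbove_range_abs_sub (p q : TreeHull hd) :
    BddAbove (Set.range fun x => |p x - q x|) := by
  obtain ⟨u, v, t, h₀, h₁, rfl⟩ := q.exists_eq_seg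
  exact ⟨_, Set.forall_mem_range.2 (p.abs_sub_le u v t h₀ h₁)⟩

noncomputable instance : Dist (TreeHull hd) := ⟨fun p q => ⨆ x, |p x - q x|⟩

theorem dist_def (p q : TreeHull hd) : dist p q = ⨆ x, |p x - q x| := rfl

theorem abs_sub_le_dist (p q : TreeHull hd) (x : X) : |p x - q x| ≤ dist p q :=
  le_ciSup (bddAbove_range_abs_sub p q) x

theorem dist_seg (p : TreeHull hd) (u v : X) (t : ℝ) (h₀ : 0 ≤ t) (h₁ : t ≤ d u v) :
    dist p (seg hd u v t h₀ h₁) = max (p u - t) (p v - (d u v - t)) := by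
  have : Nonempty X := ⟨u⟩
  refine le_antisymm (ciSup_le (p.abs_sub_le u v t h₀ h₁)) (max_le ?_ ?_)
  · refine (le_abs_self _).trans (le_trans (le_of_eq ?_) (abs_sub_le_dist p _ u))
    rw [seg_left]
  · refine (le_abs_self _).trans (le_trans (le_of_eq ?_) (abs_sub_le_dist p _ v))
    rw [seg_right]

noncomputable instance : MetricSpace (TreeHull hd) where
  dist_self p := by simp [dist_def]
  dist_comm p q := by simp only [dist_def, abs_sub_comm]
  dist_triangle p q r := by
    obtain ⟨u, -⟩ := p.exists_eq_seg
    have : Nonempty X := ⟨u⟩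
    refine ciSup_le fun x => (_root_.abs_sub_le (p x) (q x) (r x)).trans ?_
    exact add_le_add (abs_sub_le_dist p q x) (abs_sub_le_dist q r x)
  eq_of_dist_eq_zero {p q} h := by
    refine ext fun x => sub_eq_zero.1 (abs_eq_zero.1 (le_antisymm ?_ (abs_nonneg _)))
    rw [← h]
    exact abs_sub_le_dist p q x

/-- The canonical map of a `0`-hyperbolic space to its hull. -/
def point (hd : IsZeroHyperbolic d) (x : X) : TreeHull hd :=
  seg hd x x 0 le_rfl (hd.self x).ge

theorem dist_point (p : TreeHull hd) (x : X) : dist p (point hd x) = p x := by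
  rw [point, dist_seg, hd.self]; simp

theorem point_apply (x y : X) : point hd x y = d x y := by
  rw [point, seg_apply, hd.self, hd.symm y]; simp

theorem dist_point_point (x y : X) : dist (point hd x) (point hd y) = d x y := by
  rw [dist_point, point_apply]

theorem dist_seg' (p : TreeHull hd) (u v : X) (t : ℝ) (h₀ : 0 ≤ t) (h₁ : t ≤ d u v) :
    dist p (seg hd u v t h₀ h₁) =
      max (dist p (point hd u) - t) (dist p (point hd v) - (d u v - t)) := by
  rw [dist_seg, dist_point, dist_point]

/-- The four-point condition for `p` on a segment follows from that for its endpoints. -/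
theorem four_point_of_endpoints (p q r s : TreeHull hd)
    (h : ∀ x : X, dist (point hd x) q + dist r s ≤
      max (dist (point hd x) r + dist q s) (dist (point hd x) s + dist q r)) :
    dist p q + dist r s ≤ max (dist p r + dist q s) (dist p s + dist q r) := by
  obtain ⟨u, v, t, h₀, h₁, rfl⟩ := p.exists_eq_seg
  simp only [dist_comm (seg hd u v t h₀ h₁) _, dist_seg']
  simp only [dist_comm (point hd _) _] at h
  have h1 := le_max_left (dist r (point hd u) - t) (dist r (point hd v) - (d u v - t))
  have h2 := le_max_right (dist r (point hd u) - t) (dist r (point hd v) - (d u v - t))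
  have h3 := le_max_left (dist s (point hd u) - t) (dist s (point hd v) - (d u v - t))
  have h4 := le_max_right (dist s (point hd u) - t) (dist s (point hd v) - (d u v - t))
  rw [le_max_iff]
  rcases max_cases (dist q (point hd u) - t) (dist q (point hd v) - (d u v - t)) with
    ⟨h', -⟩ | ⟨h', -⟩ <;> rw [h']
  · rcases le_max_iff.1 (h u) with h | h
    · left; linarith
    · right; linarith
  · rcases le_max_iff.1 (h v) with h | h
    · left; linarith
    · right; linarith

/-- The condition is symmetric in the four points, so each in turn can be moved to first place and
replaced by endpoints in `X`. -/
theorem four_point (p q r s : TreeHull hd) :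
    dist p q + dist r s ≤ max (dist p r + dist q s) (dist p s + dist q r) := by
  refine four_point_of_endpoints p q r s fun x => ?_
  have h := four_point_of_endpoints q (point hd x) r s fun y => ?_
  · rw [dist_comm q, le_max_iff] at h
    rw [le_max_iff]
    rcases h with h | h
    · right; linarith
    · left; linarith
  have h := four_point_of_endpoints r s (point hd y) (point hd x) fun z => ?_
  · simp only [dist_comm (point hd _) r, dist_comm (point hd _) s] at h ⊢
    rwa [add_comm, add_comm (dist s (point hd y))]
  have h := four_point_of_endpoints s (point hd z) (point hd y) (point hd x) fun w => ?_
  · rw [dist_comm s (point hd z), le_max_iff] at h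
    rw [le_max_iff]
    rcases h with h | h
    · right; linarith
    · left; linarith
  simp only [dist_point_point]
  exact hd.four_point _ _ _ _

theorem eq_seg_of_add_eq (p : TreeHull hd) (u v : X) (h : p u + p v = d u v) :
    ∃ h₀ h₁, p = seg hd u v (p u) h₀ h₁ := by
  have h0 : ∀ x, 0 ≤ p x := fun x => by
    have := p.le_add x x
    rw [hd.self] at this
    linarith
  refine ⟨h0 u, by linarith [h0 v], ext fun x => ?_⟩
  rw [seg_apply]
  refine le_antisymm ?_ (max_le ?_ ?_)
  · rw [le_max_iff]
    rcases le_max_iff.1 (p.four_point_one x u v) with h' | h'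
    · right; linarith
    · left; linarith
  · linarith [p.le_add x u]
  · linarith [p.le_add x v]

/-- Any two points lie in order on one segment with ends in `X`: extend the segment between them
beyond `q`, then beyond `p`. This reduces geodesics to segments. -/
theorem exists_dist_eq (p q : TreeHull hd) : ∃ u v, d u v = p u + dist p q + q v := by
  obtain ⟨u, v, t, h₀, h₁, hq⟩ := q.exists_eq_seg
  obtain ⟨u', v', t', h₀', h₁', hp⟩ := p.exists_eq_seg
  have key : ∀ y, ∃ x, d x y = p x + p y := fun y => by
    rcases max_cases (d y u' - t') (d y v' - (d u' v' - t')) with ⟨h, -⟩ | ⟨h, -⟩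
    · refine ⟨u', ?_⟩
      rw [hp, seg_left, seg_apply, h, hd.symm u' y]; ring
    · refine ⟨v', ?_⟩
      rw [hp, seg_right, seg_apply, h, hd.symm v' y]; ring
  have hdist := p.dist_seg u v t h₀ h₁
  rw [← hq] at hdist
  rcases max_cases (p u - t) (p v - (d u v - t)) with ⟨h, -⟩ | ⟨h, -⟩
  · obtain ⟨x, hx⟩ := key u
    refine ⟨x, u, ?_⟩
    rw [hx, hdist, h, hq, seg_left]; ring
  · obtain ⟨x, hx⟩ := key v
    refine ⟨x, v, ?_⟩
    rw [hx, hdist, h, hq, seg_right]; ring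

theorem dist_seg_seg (u v : X) {s t : ℝ} (h₀ : 0 ≤ t) (h₁ : t ≤ d u v) (h₀' : 0 ≤ s)
    (h₁' : s ≤ d u v) : dist (seg hd u v s h₀' h₁') (seg hd u v t h₀ h₁) = |s - t| := by
  rw [dist_seg, seg_left, seg_right, abs_eq_max_neg]
  congr 1; ring

theorem isRTree [Nonempty X] : IsRTree (TreeHull hd) where
  nonempty := ⟨point hd (Classical.arbitrary X)⟩
  geodesic p q := by
    obtain ⟨u, v, h⟩ := exists_dist_eq p q
    have hpv : p v = dist p q + q v := by
      have h1 := p.le_add u v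
      have h2 := (le_abs_self _).trans (abs_sub_le_dist p q v)
      linarith
    have hqu : q u = p u + dist p q := by
      have h1 := q.le_add u v
      have h2 := (le_abs_self _).trans (abs_sub_le_dist q p u)
      rw [dist_comm] at h2
      linarith
    obtain ⟨p₀, p₁, hp⟩ := p.eq_seg_of_add_eq u v (by linarith)
    obtain ⟨q₀, q₁, hq⟩ := q.eq_seg_of_add_eq u v (by linarith)
    -- The parameter is clamped because the geodesic is a map on all of `ℝ`, while `seg` demands a
    -- parameter within the segment.
    have hmem : ∀ r, p u + max 0 (min r (dist p q)) ≤ d u v ∧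
        0 ≤ p u + max 0 (min r (dist p q)) := fun r => by
      have h1 : max 0 (min r (dist p q)) ≤ dist p q := max_le dist_nonneg (min_le_right _ _)
      have h2 := le_max_left 0 (min r (dist p q))
      have h3 : 0 ≤ q v := by rw [← dist_point]; exact dist_nonneg
      constructor <;> linarith
    have hr : ∀ r ∈ Set.Icc 0 (dist p q), max 0 (min r (dist p q)) = r := fun r hr => by
      rw [min_eq_left hr.2, max_eq_right hr.1]
    refine ⟨fun r => seg hd u v (p u + max 0 (min r (dist p q))) (hmem r).2 (hmem r).1, ?_, ?_, ?_⟩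
    · conv_rhs => rw [hp]
      beta_reduce
      congr 1
      rw [hr 0 ⟨le_rfl, dist_nonneg⟩, add_zero]
    · conv_rhs => rw [hq]
      beta_reduce
      congr 1
      rw [hr _ ⟨dist_nonneg, le_rfl⟩, hqu]
    · intro s hs t ht
      rw [dist_seg_seg, hr s hs, hr t ht]
      congr 1; ring
  four_point := four_point

/-- A point of the hull is determined by its distances to two points whose segment contains it. -/
theorem eq_of_dist_add_dist_eq (p q r s : TreeHull hd) (hr : dist p r + dist q s ≤ dist r s)
    (hs : dist p s + dist q r ≤ dist r s) : p = q := by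
  rw [← dist_eq_zero]
  refine le_antisymm ?_ dist_nonneg
  have := (four_point p q r s).trans (max_le hr hs)
  linarith

/-- A subtree contains every point of a segment between two of its points. -/
theorem mem_of_isRTree {S : Set (TreeHull hd)} (hS : IsRTree S) {p r s : TreeHull hd} (hr : r ∈ S)
    (hs : s ∈ S) (h : dist r p + dist p s = dist r s) : p ∈ S := by
  obtain ⟨γ, h0, h1, hγ⟩ := hS.geodesic ⟨r, hr⟩ ⟨s, hs⟩
  change γ (dist r s) = _ at h1
  change ∀ s' ∈ Set.Icc 0 (dist r s), ∀ t ∈ Set.Icc 0 (dist r s), _ at hγ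
  have m0 : (0 : ℝ) ∈ Set.Icc 0 (dist r s) := ⟨le_rfl, dist_nonneg⟩
  have m1 : dist r s ∈ Set.Icc 0 (dist r s) := ⟨dist_nonneg, le_rfl⟩
  have m : dist r p ∈ Set.Icc 0 (dist r s) :=
    ⟨dist_nonneg, by linarith [dist_nonneg (x := p) (y := s)]⟩
  have e0 := hγ _ m _ m0
  have e1 := hγ _ m _ m1
  rw [h0, Subtype.dist_eq, sub_zero, abs_of_nonneg dist_nonneg] at e0
  rw [h1, Subtype.dist_eq, abs_of_nonpos (by linarith [m.2])] at e1
  have : p = (γ (dist r p) : TreeHull hd) := by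
    refine eq_of_dist_add_dist_eq _ _ r s ?_ ?_
    · rw [e1, dist_comm p r]; linarith
    · rw [e0]; linarith
  rw [this]
  exact (γ _).2

end TreeHull

/-! ### Weighted word metrics on free groups. -/

/-- The total weight of the letters of a word. -/
def wordWeight {α : Type*} (w : α → ℝ) (l : List (α × Bool)) : ℝ := (l.map fun x => w x.1).sum

section wordWeight

variable {α : Type*} (w : α → ℝ)

@[simp] theorem wordWeight_nil : wordWeight w [] = 0 := rfl

@[simp] theorem wordWeight_cons (x : α × Bool) (l : List (α × Bool)) :
    wordWeight w (x :: l) = w x.1 + wordWeight w l := by simp [wordWeight]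

@[simp] theorem wordWeight_append (l₁ l₂ : List (α × Bool)) :
    wordWeight w (l₁ ++ l₂) = wordWeight w l₁ + wordWeight w l₂ := by simp [wordWeight]

@[simp] theorem wordWeight_invRev (l : List (α × Bool)) :
    wordWeight w (FreeGroup.invRev l) = wordWeight w l := by
  simp [wordWeight, FreeGroup.invRev, Function.comp_def, List.sum_reverse]

theorem wordWeight_nonneg (hw : ∀ x, 0 ≤ w x) (l : List (α × Bool)) : 0 ≤ wordWeight w l :=
  List.sum_nonneg (by simpa using fun a _ => hw a)

end wordWeight

/-- The longest common prefix of two lists. -/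
def longestCommonPrefix {β : Type*} [DecidableEq β] : List β → List β → List β
  | x :: l₁, y :: l₂ => if x = y then x :: longestCommonPrefix l₁ l₂ else []
  | _, _ => []

theorem longestCommonPrefix_comm {β : Type*} [DecidableEq β] (l₁ l₂ : List β) :
    longestCommonPrefix l₁ l₂ = longestCommonPrefix l₂ l₁ := by
  induction l₁ generalizing l₂ with
  | nil => cases l₂ <;> simp [longestCommonPrefix]
  | cons x l₁ ih =>
    cases l₂ with
    | nil => simp [longestCommonPrefix]
    | cons y l₂ =>
      by_cases h : x = y
      · simp [longestCommonPrefix, h, ih l₂]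
      · simp [longestCommonPrefix, h, Ne.symm h]

/-- Longest common prefixes satisfy the ultrametric inequality. -/
theorem min_wordWeight_longestCommonPrefix_le {α : Type*} [DecidableEq α] {w : α → ℝ}
    (hw : ∀ x, 0 ≤ w x) (l₁ l₂ l₃ : List (α × Bool)) :
    min (wordWeight w (longestCommonPrefix l₁ l₂)) (wordWeight w (longestCommonPrefix l₂ l₃)) ≤
      wordWeight w (longestCommonPrefix l₁ l₃) := by
  induction l₁ generalizing l₂ l₃ with
  | nil => exact min_le_of_left_le (by simp [longestCommonPrefix])
  | cons x l₁ ih =>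
    have h0 := wordWeight_nonneg w hw
    cases l₂ with
    | nil => exact min_le_of_left_le (by simpa [longestCommonPrefix] using h0 _)
    | cons y l₂ =>
      cases l₃ with
      | nil => exact min_le_of_right_le (by simp [longestCommonPrefix])
      | cons z l₃ =>
        by_cases hxy : x = y
        · subst hxy
          by_cases hxz : x = z
          · subst hxz
            simpa [longestCommonPrefix, min_add_add_left] using ih l₂ l₃
          · exact min_le_of_right_le (by simp [longestCommonPrefix, hxz])
        · exact min_le_of_left_le (by simpa [longestCommonPrefix, hxy] using h0 _)

namespace FreeGroup

variable {α : Type*} [DecidableEq α] (w : α → ℝ)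

/-- The weighted word length of an element of a free group. -/
def weightedNorm (g : FreeGroup α) : ℝ := wordWeight w g.toWord

theorem weightedNorm_mk_of_isReduced {l : List (α × Bool)} (h : IsReduced l) :
    weightedNorm w (mk l) = wordWeight w l := by
  rw [weightedNorm, toWord_mk, h.reduce_eq]

theorem weightedNorm_one : weightedNorm w (1 : FreeGroup α) = 0 := by simp [weightedNorm]

theorem weightedNorm_inv (g : FreeGroup α) : weightedNorm w g⁻¹ = weightedNorm w g := by
  simp [weightedNorm]

theorem IsReduced.invRev_append_of_ne {l₁ l₂ : List (α × Bool)} (h₁ : IsReduced l₁)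
    (h₂ : IsReduced l₂) (h : ∀ x ∈ l₁.head?, ∀ y ∈ l₂.head?, x ≠ y) :
    IsReduced (invRev l₁ ++ l₂) := by
  rw [IsReduced, List.isChain_append]
  refine ⟨?_, h₂, ?_⟩
  · have : reduce (invRev l₁) = invRev l₁ := by rw [reduce_invRev, h₁.reduce_eq]
    exact IsReduced.of_reduce_eq this
  · cases l₁ with
    | nil => simp
    | cons x l₁ =>
      intro x' hx' y hy
      simp only [invRev, List.map_cons, List.reverse_cons, List.getLast?_append,
        List.getLast?_singleton, Option.mem_def, Option.some_or, Option.some.injEq] at hx'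
      subst hx'
      intro h1
      have := h x (by simp) y hy
      by_contra h2
      exact this (Prod.ext h1 (by simpa using h2))

theorem weightedNorm_inv_mul_of_isReduced {l₁ l₂ : List (α × Bool)} (h₁ : IsReduced l₁)
    (h₂ : IsReduced l₂) : weightedNorm w ((mk l₁)⁻¹ * mk l₂) =
      wordWeight w l₁ + wordWeight w l₂ - 2 * wordWeight w (longestCommonPrefix l₁ l₂) := by
  induction l₁ generalizing l₂ with
  | nil =>
    simp only [inv_mk, invRev_empty, mul_mk, List.nil_append, weightedNorm_mk_of_isReduced w h₂]
    simp [longestCommonPrefix]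
  | cons x l₁ ih =>
    by_cases h : ∀ y ∈ l₂.head?, x ≠ y
    · have : longestCommonPrefix (x :: l₁) l₂ = [] := by
        cases l₂ with
        | nil => rfl
        | cons y l₂ => simp [longestCommonPrefix, h y (by simp)]
      rw [this, inv_mk, mul_mk, weightedNorm_mk_of_isReduced w
        (h₁.invRev_append_of_ne h₂ (by simpa using h))]
      simp
    · push Not at h
      obtain ⟨y, hy, rfl⟩ := h
      obtain ⟨l₂, rfl⟩ : ∃ l, l₂ = x :: l := by
        cases l₂ with
        | nil => simp at hy
        | cons y l => exact ⟨l, by simp at hy; rw [hy]⟩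
      have e : (mk (x :: l₁))⁻¹ * mk (x :: l₂) = (mk l₁)⁻¹ * mk l₂ := by
        rw [← List.singleton_append, ← List.singleton_append (l := l₂), ← mul_mk, ← mul_mk]
        group
      rw [e, ih (h₁.infix ⟨[x], [], by simp⟩) (h₂.infix ⟨[x], [], by simp⟩)]
      simp only [longestCommonPrefix, if_true, wordWeight_cons]
      ring

/-- Exactly the common prefix cancels, so its weight is the Gromov product of `g` and `h` at `1`. -/
theorem weightedNorm_inv_mul (g h : FreeGroup α) : weightedNorm w (g⁻¹ * h) =
    weightedNorm w g + weightedNorm w h -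
      2 * wordWeight w (longestCommonPrefix g.toWord h.toWord) := by
  have := weightedNorm_inv_mul_of_isReduced w (isReduced_toWord (x := g))
    (isReduced_toWord (x := h))
  rwa [mk_toWord, mk_toWord] at this

/-- The weighted word metric on a free group is `0`-hyperbolic. -/
theorem isZeroHyperbolic_weightedNorm {w : α → ℝ} (hw : ∀ x, 0 ≤ w x) :
    IsZeroHyperbolic fun g h : FreeGroup α => weightedNorm w (g⁻¹ * h) where
  self g := by simp [weightedNorm_one]
  symm g h := by rw [← weightedNorm_inv]; group
  four_point x y z t := by
    simp only [weightedNorm_inv_mul]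
    -- Once the norms cancel, the four-point condition compares sums of two Gromov products and
    -- follows from four ultrametric inequalities.
    have key := fun g₁ g₂ g₃ : FreeGroup α => min_le_iff.1
      (min_wordWeight_longestCommonPrefix_le hw g₁.toWord g₂.toWord g₃.toWord)
    have h₁ := key x z y
    have h₂ := key x t y
    have h₃ := key z x t
    have h₄ := key z y t
    rw [longestCommonPrefix_comm z.toWord y.toWord] at h₁ h₄
    rw [longestCommonPrefix_comm t.toWord y.toWord] at h₂
    rw [longestCommonPrefix_comm z.toWord x.toWord] at h₃
    rw [le_max_iff]
    by_contra! h
    obtain ⟨h, h'⟩ := h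
    rcases h₁ with h₁ | h₁ <;> rcases h₂ with h₂ | h₂ <;> rcases h₃ with h₃ | h₃ <;>
      rcases h₄ with h₄ | h₄ <;> linarith

/-- A nontrivial element of a free group has cyclically reduced length at least that of the
shortest letter. -/
theorem le_weightedNorm_mul_self_sub {w : α → ℝ} {ε : ℝ} (hε : 0 ≤ ε) (hw : ∀ x, ε ≤ w x)
    {g : FreeGroup α} (hg : g ≠ 1) : ε ≤ weightedNorm w (g * g) - weightedNorm w g := by
  -- If `g = u * r * u⁻¹` with `r` cyclically reduced, the reduced word of `g * g` is `u r r u⁻¹`,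
  -- so the difference of norms is the weight of `r`.
  have h2 := reduceCyclically.reduce_flatten_replicate_succ (isReduced_toWord (x := g)) 1
  have h1 := reduceCyclically.conj_conjugator_reduceCyclically g.toWord
  have e : reduceCyclically g.toWord ≠ [] := by
    intro h
    rw [h, List.append_nil] at h1
    apply hg
    rw [← mk_toWord (x := g), ← h1, ← mul_mk, ← inv_mk, mul_inv_cancel]
  obtain ⟨x, l, hl⟩ := List.exists_cons_of_ne_nil e
  rw [weightedNorm, weightedNorm, toWord_mul]
  have h3 : (List.replicate (1 + 1) g.toWord).flatten = g.toWord ++ g.toWord := by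
    simp [List.replicate_succ]
  rw [← h3, h2]
  have h4 := congrArg (wordWeight w) h1
  simp only [hl, wordWeight_append, wordWeight_invRev, List.replicate_succ, List.replicate_zero,
    List.flatten_cons, List.flatten_nil, wordWeight_cons, wordWeight_nil] at h4 ⊢
  linarith [hw x.1, wordWeight_nonneg w (fun x => hε.trans (hw x)) l]

end FreeGroup

/-! ### Group actions on trees of length functions. -/

theorem IsZeroHyperbolic.comap {X Y : Type*} {d : Y → Y → ℝ} (hd : IsZeroHyperbolic d) (f : X → Y) :
    IsZeroHyperbolic fun x y => d (f x) (f y) where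
  self _ := hd.self _
  symm _ _ := hd.symm _ _
  four_point _ _ _ _ := hd.four_point _ _ _ _

/-- The left-invariant distance on a group defined by a length function. -/
def normDist {G : Type*} [Group G] (ℓ : G → ℝ) (x y : G) : ℝ := ℓ (x⁻¹ * y)

theorem normDist_mul_left {G : Type*} [Group G] (ℓ : G → ℝ) (g x y : G) :
    normDist ℓ (g * x) (g * y) = normDist ℓ x y := by
  simp only [normDist, mul_inv_rev, mul_assoc, inv_mul_cancel_left]

theorem normDist_one_left {G : Type*} [Group G] (ℓ : G → ℝ) (x : G) : normDist ℓ 1 x = ℓ x := by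
  simp [normDist]

theorem normDist_inv_mul_left {G : Type*} [Group G] (ℓ : G → ℝ) (g x y : G) :
    normDist ℓ (g⁻¹ * x) y = normDist ℓ x (g * y) := by
  simp [normDist, mul_assoc]

namespace TreeHull

variable {G : Type*} [Group G] {ℓ : G → ℝ} {hd : IsZeroHyperbolic (normDist ℓ)}

theorem segmentPoint_inv_mul (g u v : G) (t : ℝ) (x : G) :
    segmentPoint (normDist ℓ) u v t (g⁻¹ * x) = segmentPoint (normDist ℓ) (g * u) (g * v) t x := by
  rw [segmentPoint, segmentPoint, normDist_inv_mul_left, normDist_inv_mul_left, normDist_mul_left]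

/-- The left translation action of a group on the tree of a length function. -/
instance : MulAction G (TreeHull hd) where
  smul g p := ⟨fun x => p (g⁻¹ * x), by
    obtain ⟨u, v, t, h₀, h₁, h⟩ := p.exists_eq
    refine ⟨g * u, g * v, t, h₀, by rwa [normDist_mul_left], funext fun x => ?_⟩
    rw [h, segmentPoint_inv_mul]⟩
  one_smul p := ext fun x => by
    change p (1⁻¹ * x) = p x
    simp
  mul_smul g h p := ext fun x => by
    change p ((g * h)⁻¹ * x) = p (h⁻¹ * (g⁻¹ * x))
    simp [mul_assoc]

theorem smul_apply (g : G) (p : TreeHull hd) (x : G) : (g • p) x = p (g⁻¹ * x) := rfl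

theorem dist_smul_smul (g : G) (p q : TreeHull hd) : dist (g • p) (g • q) = dist p q :=
  Equiv.iSup_congr (Equiv.mulLeft g⁻¹) fun _ => rfl

theorem smul_point (g x : G) : g • point hd x = point hd (g * x) := ext fun y => by
  rw [smul_apply, point_apply, point_apply, hd.symm, normDist_inv_mul_left, hd.symm]

theorem smul_seg (g u v : G) (t : ℝ) (h₀ : 0 ≤ t) (h₁ : t ≤ normDist ℓ u v) :
    g • seg hd u v t h₀ h₁ =
      seg hd (g * u) (g * v) t h₀ (by rwa [normDist_mul_left]) := ext fun x => by
  rw [smul_apply]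
  exact segmentPoint_inv_mul g u v t x

/-- Four-point condition for `1`, `g * g`, `g • p` and `g`, followed by the triangle inequality.
This bound also yields freeness and discreteness. -/
theorem sub_le_dist_smul (g : G) (p : TreeHull hd) : ℓ (g * g) - ℓ g ≤ dist p (g • p) := by
  have key := four_point (point hd 1) (point hd (g * g)) (g • p) (g • point hd 1)
  have h1 : dist (point hd 1) (point hd (g * g)) = ℓ (g * g) := by
    rw [dist_point_point, normDist_one_left]
  have h2 : dist (g • p) (g • point hd 1) = dist p (point hd 1) := dist_smul_smul _ _ _
  have h3 : dist (point hd 1) (g • point hd 1) = ℓ g := by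
    rw [smul_point, dist_point_point, normDist_one_left, mul_one]
  have h4 : g • g • point hd 1 = point hd (g * g) := by rw [smul_point, smul_point, mul_one]
  have h5 : dist (point hd (g * g)) (g • point hd 1) = ℓ g := by
    rw [← h4, dist_smul_smul, dist_comm, h3]
  have h6 : dist (point hd (g * g)) (g • p) = dist (g • point hd 1) p := by
    rw [← h4, dist_smul_smul]
  have h7 := dist_triangle (g • point hd 1) (g • p) p
  have h8 := dist_triangle (point hd 1) p (g • p)
  rw [dist_smul_smul, dist_comm (point hd 1) p, dist_comm (g • p)] at h7
  rw [dist_comm (point hd 1) p] at h8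
  rw [h1, h2, h3, h5, h6] at key
  rcases le_max_iff.1 key with h | h <;> linarith

/-- The witness is the midpoint of `[1, g]`, which attains the minimal displacement. -/
theorem exists_dist_smul_le (hd : IsZeroHyperbolic (normDist ℓ)) (g : G) :
    ∃ p : TreeHull hd, dist p (g • p) ≤ max 0 (ℓ (g * g) - ℓ g) := by
  have hg : 0 ≤ ℓ g := by simpa [normDist_one_left] using hd.nonneg 1 g
  have e : normDist ℓ 1 g = ℓ g := normDist_one_left ℓ g
  have e' : normDist ℓ 1 (g * g) = ℓ (g * g) := normDist_one_left ℓ _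
  have e'' : normDist ℓ g (g * g) = ℓ g := by simp [normDist]
  have e₁ : normDist ℓ g 1 = ℓ g := by rw [hd.symm, e]
  have e₁' : normDist ℓ (g * g) 1 = ℓ (g * g) := by rw [hd.symm, e']
  have e₁'' : normDist ℓ (g * g) g = ℓ g := by rw [hd.symm, e'']
  refine ⟨seg hd 1 g (ℓ g / 2) (by linarith) (by linarith), ?_⟩
  rw [smul_seg, dist_seg, seg_apply, seg_apply, mul_one, e, e₁, e'', hd.self, e₁', e₁'']
  refine max_le (sub_le_iff_le_add.2 (max_le ?_ ?_)) (sub_le_iff_le_add.2 (max_le ?_ ?_))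
  · linarith [le_max_left 0 (ℓ (g * g) - ℓ g)]
  · linarith [le_max_left 0 (ℓ (g * g) - ℓ g)]
  · linarith [le_max_right 0 (ℓ (g * g) - ℓ g)]
  · linarith [le_max_left 0 (ℓ (g * g) - ℓ g)]

theorem iInf_dist_smul (hd : IsZeroHyperbolic (normDist ℓ)) (g : G) :
    ⨅ p : TreeHull hd, dist p (g • p) = max 0 (ℓ (g * g) - ℓ g) := by
  have : Nonempty (TreeHull hd) := ⟨point hd 1⟩
  refine le_antisymm ?_ (le_ciInf fun p => max_le dist_nonneg (sub_le_dist_smul g p))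
  obtain ⟨p, hp⟩ := exists_dist_smul_le hd g
  exact (ciInf_le ⟨0, Set.forall_mem_range.2 fun _ => dist_nonneg⟩ p).trans hp

theorem discreteTopology_orbit {ε : ℝ} (hε : 0 < ε) (h : ∀ g : G, g ≠ 1 → ε ≤ ℓ (g * g) - ℓ g)
    (p : TreeHull hd) : DiscreteTopology (MulAction.orbit G p) := by
  refine DiscreteTopology.of_forall_le_dist hε ?_
  rintro ⟨_, g, rfl⟩ ⟨_, k, rfl⟩ hne
  have hgk : g⁻¹ * k ≠ 1 := fun e => hne (by rw [inv_mul_eq_one.1 e])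
  have := (h _ hgk).trans (sub_le_dist_smul (g⁻¹ * k) p)
  rw [← dist_smul_smul g, mul_smul, smul_inv_smul] at this
  exact this

/-- If `1` separates translates `g • [u, v]` and `k • [u, v]`, then it lies between the translates
of any point of `[u, v]`. -/
theorem dist_smul_point_one_add (g k u v : G) (t : ℝ) (h₀ : 0 ≤ t) (h₁ : t ≤ normDist ℓ u v)
    (h : ∀ x ∈ ({u, v} : Set G), ∀ y ∈ ({u, v} : Set G),
      ℓ ((g * x)⁻¹ * (k * y)) = ℓ (g * x) + ℓ (k * y)) :
    dist (g • seg hd u v t h₀ h₁) (point hd 1) + dist (point hd 1) (k • seg hd u v t h₀ h₁) =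
      dist (g • seg hd u v t h₀ h₁) (k • seg hd u v t h₀ h₁) := by
  refine le_antisymm ?_ (dist_triangle _ _ _)
  have h' : ∀ x ∈ ({u, v} : Set G), ∀ y ∈ ({u, v} : Set G),
      normDist ℓ (k * y) (g * x) = ℓ (g * x) + ℓ (k * y) := fun x hx y hy => by
    rw [hd.symm]; exact h x hx y hy
  have hu : u ∈ ({u, v} : Set G) := Or.inl rfl
  have hv : v ∈ ({u, v} : Set G) := Or.inr rfl
  have key : ∀ y ∈ ({u, v} : Set G), (g • seg hd u v t h₀ h₁) (k * y) =
      (g • seg hd u v t h₀ h₁) 1 + ℓ (k * y) := fun y hy => by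
    rw [smul_seg, seg_apply, seg_apply, h' u hu y hy, h' v hv y hy, normDist_one_left,
      normDist_one_left, ← max_add_add_right]
    congr 1 <;> ring
  rw [dist_comm (point hd 1), dist_point, dist_point]
  have h1 := (le_abs_self _).trans
    (abs_sub_le_dist (g • seg hd u v t h₀ h₁) (k • seg hd u v t h₀ h₁) (k * u))
  have h2 := (le_abs_self _).trans
    (abs_sub_le_dist (g • seg hd u v t h₀ h₁) (k • seg hd u v t h₀ h₁) (k * v))
  rw [key u hu] at h1
  rw [key v hv] at h2
  rw [smul_seg k, seg_left] at h1
  rw [smul_seg k, seg_right] at h2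
  rw [smul_seg k, seg_apply, normDist_one_left, normDist_one_left]
  rcases max_cases (ℓ (k * u) - t) (ℓ (k * v) - (normDist ℓ (k * u) (k * v) - t)) with
    ⟨e, -⟩ | ⟨e, -⟩ <;> rw [e] <;> linarith

/-- An invariant subtree contains two translates of one of its points with `1` between them, hence
`1`, hence the orbit of `1` and all segments between its points. -/
theorem eq_univ_of_isRTree (h : ∀ u v : G, ∃ g k : G, ∀ x ∈ ({u, v} : Set G),
      ∀ y ∈ ({u, v} : Set G), ℓ ((g * x)⁻¹ * (k * y)) = ℓ (g * x) + ℓ (k * y))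
    (S : Set (TreeHull hd)) (hS : ∀ g : G, ∀ p ∈ S, g • p ∈ S) (hT : IsRTree S) :
    S = Set.univ := by
  have h1 : point hd 1 ∈ S := by
    obtain ⟨⟨p, hp⟩⟩ := hT.nonempty
    obtain ⟨u, v, t, h₀, h₁, rfl⟩ := p.exists_eq_seg
    obtain ⟨g, k, hgk⟩ := h u v
    exact mem_of_isRTree hT (hS g _ hp) (hS k _ hp) (dist_smul_point_one_add g k u v t h₀ h₁ hgk)
  have hpt : ∀ x, point hd x ∈ S := fun x => by
    have := hS x _ h1
    rwa [smul_point, mul_one] at this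
  refine Set.eq_univ_of_forall fun p => ?_
  obtain ⟨u, v, t, h₀, h₁, rfl⟩ := p.exists_eq_seg
  refine mem_of_isRTree hT (hpt u) (hpt v) ?_
  rw [dist_comm (point hd u), dist_point, dist_point, dist_point_point, seg_left, seg_right]
  ring

end TreeHull

/-- The tree of a length function on a free group. -/
noncomputable def FreeGroupTree.ofNorm {N : ℕ} (ℓ : FreeGroup (Fin N) → ℝ)
    (hd : IsZeroHyperbolic (normDist ℓ)) {ε : ℝ} (hε : 0 < ε)
    (hℓ : ∀ g, g ≠ 1 → ε ≤ ℓ (g * g) - ℓ g)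
    (hmin : ∀ u v, ∃ g k, ∀ x ∈ ({u, v} : Set (FreeGroup (Fin N))),
      ∀ y ∈ ({u, v} : Set (FreeGroup (Fin N))), ℓ ((g * x)⁻¹ * (k * y)) = ℓ (g * x) + ℓ (k * y)) :
    FreeGroupTree N where
  carrier := TreeHull hd
  isRTree := TreeHull.isRTree
  isometric := TreeHull.dist_smul_smul
  free g p h := by
    by_contra hg
    have := (hℓ g hg).trans (TreeHull.sub_le_dist_smul g p)
    rw [h, dist_self] at this
    linarith
  minimal := TreeHull.eq_univ_of_isRTree hmin
  discrete := TreeHull.discreteTopology_orbit hε hℓ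

theorem FreeGroupTree.translationLength_ofNorm {N : ℕ} (ℓ : FreeGroup (Fin N) → ℝ)
    (hd : IsZeroHyperbolic (normDist ℓ)) {ε : ℝ} (hε : 0 < ε)
    (hℓ : ∀ g, g ≠ 1 → ε ≤ ℓ (g * g) - ℓ g)
    (hmin : ∀ u v, ∃ g k, ∀ x ∈ ({u, v} : Set (FreeGroup (Fin N))),
      ∀ y ∈ ({u, v} : Set (FreeGroup (Fin N))), ℓ ((g * x)⁻¹ * (k * y)) = ℓ (g * x) + ℓ (k * y))
    (g : FreeGroup (Fin N)) :
    (FreeGroupTree.ofNorm ℓ hd hε hℓ hmin).translationLength g = max 0 (ℓ (g * g) - ℓ g) :=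
  TreeHull.iInf_dist_smul hd g

theorem FreeGroupTree.translationLength_conj {N : ℕ} (T : FreeGroupTree N)
    (h g : FreeGroup (Fin N)) : T.translationLength (h * g * h⁻¹) = T.translationLength g := by
  refine (Equiv.iInf_congr (MulAction.toPerm h) fun x => ?_).symm
  simp only [MulAction.toPerm_apply, mul_smul, inv_smul_smul, T.isometric]

/-! ### The homomorphism `twist` and its reduced words. -/

namespace FreeGroup

section Words

variable {α : Type*}

/-- The reduced word of an integral power of the letter `some i`. -/
def powWord (i : α) (e : ℤ) : List (Option α × Bool) :=
  List.replicate e.natAbs (some i, decide (0 ≤ e))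

theorem mk_replicate {β : Type*} (x : β) (n : ℕ) : mk (List.replicate n (x, true)) = of x ^ n := by
  induction n with
  | zero => rfl
  | succ n ih => rw [List.replicate_succ, ← List.singleton_append, ← mul_mk, ih, pow_succ']; rfl

theorem mk_replicate_false {β : Type*} (x : β) (n : ℕ) :
    mk (List.replicate n (x, false)) = (of x ^ n)⁻¹ := by
  rw [← mk_replicate, inv_mk]
  simp [invRev]

theorem mk_powWord (i : α) (e : ℤ) : mk (powWord i e) = of (some i) ^ e := by
  obtain ⟨n, rfl | rfl⟩ := e.eq_nat_or_neg
  · simp [powWord, mk_replicate]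
  · rcases n.eq_zero_or_pos with rfl | hn
    · simp [powWord, one_eq_mk]
    · simp [powWord, hn.ne', mk_replicate_false]

theorem mk_cons_true {β : Type*} (x : β) (l : List (β × Bool)) :
    mk ((x, true) :: l) = of x * mk l := by
  rw [← List.singleton_append, ← mul_mk]; rfl

theorem mk_cons_false {β : Type*} (x : β) (l : List (β × Bool)) :
    mk ((x, false) :: l) = (of x)⁻¹ * mk l := by
  rw [← List.singleton_append, ← mul_mk]; rfl

theorem IsReduced.replicate_append_cons {β : Type*} {z y : β × Bool} (h : z.1 ≠ y.1)
    {t : List (β × Bool)} (ht : IsReduced (y :: t)) (m : ℕ) :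
    IsReduced (List.replicate m z ++ y :: t) := by
  induction m with
  | zero => exact ht
  | succ m ih =>
    rw [List.replicate_succ, List.cons_append]
    cases m with
    | zero => exact List.isChain_cons_cons.2 ⟨fun e => (h e).elim, ht⟩
    | succ m => exact List.isChain_cons_cons.2 ⟨fun _ => rfl, ih⟩

theorem IsReduced.cons_powWord {i : α} {o : Option α × Bool} (ho : o.1 ≠ some i) (e : ℤ) :
    IsReduced (o :: powWord i e) := by
  rw [powWord]
  cases e.natAbs with
  | zero => exact List.isChain_singleton _
  | succ m =>
    refine List.isChain_cons_cons.2 ⟨fun e => (ho e).elim, ?_⟩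
    exact List.isChain_replicate_of_rel (m + 1) fun _ => rfl

theorem IsReduced.cons_powWord_append {i : α} {o y : Option α × Bool} {t : List (Option α × Bool)}
    (ho : o.1 ≠ some i) (hy : y.1 ≠ some i) (ht : IsReduced (y :: t)) (e : ℤ)
    (h : e = 0 → o.1 = y.1 → o.2 = y.2) : IsReduced (o :: (powWord i e ++ y :: t)) := by
  rw [powWord]
  have := IsReduced.replicate_append_cons (z := (some i, decide (0 ≤ e))) (Ne.symm hy) ht
    e.natAbs
  rcases hm : e.natAbs with _ | m
  · exact List.isChain_cons_cons.2 ⟨h (Int.natAbs_eq_zero.1 hm), ht⟩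
  · rw [hm] at this
    exact List.isChain_cons_cons.2 ⟨fun e => (ho e).elim, this⟩

end Words

variable {α : Type*} [DecidableEq α]

/-- The homomorphism to the free group with an additional letter `s` that maps the letter `j` to
`i ^ L * s * j * s⁻¹` and fixes all other letters. -/
def twist (i j : α) (L : ℕ) : FreeGroup α →* FreeGroup (Option α) :=
  lift fun x => if x = j then of (some i) ^ L * of none * of (some j) * (of none)⁻¹ else of (some x)

theorem twist_of_self (i j : α) (L : ℕ) :
    twist i j L (of j) = of (some i) ^ L * of none * of (some j) * (of none)⁻¹ := by
  simp [twist]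

theorem twist_of_ne {i j x : α} (L : ℕ) (h : x ≠ j) : twist i j L (of x) = of (some x) := by
  simp [twist, h]

theorem twist_injective {i j : α} (hij : i ≠ j) (L : ℕ) : Function.Injective (twist i j L) := by
  -- A left inverse: kill the stick and undo the factor `i ^ L`.
  let r : FreeGroup (Option α) →* FreeGroup α := lift fun x =>
    x.elim 1 fun y => if y = j then (of i ^ L)⁻¹ * of j else of y
  have h : r.comp (twist i j L) = MonoidHom.id _ := by
    ext x
    by_cases hx : x = j
    · subst hx
      simp [twist_of_self, r, hij]
    · simp [twist_of_ne L hx, r, hx]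
  exact Function.LeftInverse.injective (g := r) fun x => DFunLike.congr_fun h x

/-- The word for `i ^ e * twist i j L l` obtained from `l` by collecting powers of `i`. -/
def twistWord (i j : α) (L : ℕ) : ℤ → List (α × Bool) → List (Option α × Bool)
  | e, [] => powWord i e
  | e, (x, s) :: l =>
    if x = i then twistWord i j L (e + if s then 1 else -1) l
    else if x = j then
      if s then powWord i (e + L) ++
        (none, true) :: (some j, true) :: (none, false) :: twistWord i j L 0 l
      else powWord i e ++
        (none, true) :: (some j, false) :: (none, false) :: twistWord i j L (-L) l
    else powWord i e ++ (some x, s) :: twistWord i j L 0 l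

theorem mk_twistWord {i j : α} (hij : i ≠ j) (L : ℕ) (e : ℤ) (l : List (α × Bool)) :
    mk (twistWord i j L e l) = of (some i) ^ e * twist i j L (mk l) := by
  induction l generalizing e with
  | nil => rw [twistWord, mk_powWord, ← one_eq_mk, _root_.map_one, mul_one]
  | cons x l ih =>
    obtain ⟨x, s⟩ := x
    rw [twistWord]
    split_ifs with h₁ h₂ h₃ h₄
    · subst h₁ h₂
      rw [ih, mk_cons_true, _root_.map_mul, twist_of_ne L hij, zpow_add, zpow_one, mul_assoc]
    · subst h₁
      rw [Bool.not_eq_true] at h₂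
      subst h₂
      rw [ih, mk_cons_false, _root_.map_mul, _root_.map_inv, twist_of_ne L hij, zpow_add,
        zpow_neg_one, mul_assoc]
    · subst h₃ h₄
      rw [← mul_mk, mk_powWord, mk_cons_true, mk_cons_true, mk_cons_true, mk_cons_false, ih,
        _root_.map_mul, twist_of_self, zpow_zero, zpow_add, zpow_natCast]
      simp only [mul_assoc, one_mul]
    · subst h₃
      rw [Bool.not_eq_true] at h₄
      subst h₄
      rw [← mul_mk, mk_powWord, mk_cons_false, mk_cons_true, mk_cons_false, mk_cons_false, ih,
        _root_.map_mul, _root_.map_inv, twist_of_self, zpow_neg, zpow_natCast]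
      simp only [mul_assoc, mul_inv_rev, inv_inv]
    · rw [← mul_mk, mk_powWord]
      cases s
      · rw [mk_cons_false, mk_cons_false, ih, _root_.map_mul, _root_.map_inv, twist_of_ne L h₃,
          zpow_zero, one_mul]
      · rw [mk_cons_true, mk_cons_true, ih, _root_.map_mul, twist_of_ne L h₃,
          zpow_zero, one_mul]

theorem wordWeight_twistWord {i j : α} (L : ℕ) {w w' : Option α → ℝ}
    (h : ∀ x, x ≠ j → w (some x) = w' (some x)) (hij : i ≠ j)
    (hj : 2 * w none + w (some j) = 2 * w' none + w' (some j)) (e : ℤ) (l : List (α × Bool)) :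
    wordWeight w (twistWord i j L e l) = wordWeight w' (twistWord i j L e l) := by
  have hp : ∀ e, wordWeight w (powWord i e) = wordWeight w' (powWord i e) := fun e => by
    simp [powWord, wordWeight, h i hij]
  induction l generalizing e with
  | nil => exact hp e
  | cons x l ih =>
    obtain ⟨x, s⟩ := x
    rw [twistWord]
    split_ifs with h₁ h₂ h₃ h₄
    · exact ih _
    · exact ih _
    · simp only [wordWeight_append, wordWeight_cons, hp, ih]; linarith
    · simp only [wordWeight_append, wordWeight_cons, hp, ih]; linarith
    · simp only [wordWeight_append, wordWeight_cons, hp, ih, h x h₃]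

/-- The last letter that `twistWord` writes for a letter other than `i`; the value at `none` stands
for the beginning of a word. -/
def twistLast (j : α) : Option (α × Bool) → Option α × Bool
  | none => (none, true)
  | some (x, s) => if x = j then (none, false) else (some x, s)

/-- The exponent of `i` that `twistWord` carries over after a letter. -/
def twistShift (j : α) (L : ℕ) : Option (α × Bool) → ℤ
  | none => 0
  | some (x, s) => if x = j ∧ s = false then -L else 0

/-- Induction along the word. The state is the last letter `x` other than `i`, the run of `n`
letters `(i, ε)` read since, and the exponent `e` of `i` not yet written. Runs shorter than `L`
cannot compensate a shift by `±L`. -/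
theorem IsReduced.cons_twistWord {i j : α} (hij : i ≠ j) {L : ℕ} (l : List (α × Bool))
    (x : Option (α × Bool)) (n : ℕ) (ε : Bool) (e : ℤ)
    (he : e = twistShift j L x + if ε = true then (n : ℤ) else -n) (hx : ∀ y ∈ x, y.1 ≠ i)
    (hl : IsReduced (x.toList ++ (List.replicate n (i, ε) ++ l)))
    (hL : ∀ k δ, List.replicate k (i, δ) <:+: List.replicate n (i, ε) ++ l → k < L) :
    IsReduced (twistLast j x :: twistWord i j L e l) := by
  have ho : (twistLast j x).1 ≠ some i := by
    rcases x with _ | ⟨x, s⟩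
    · simp [twistLast]
    · have := hx _ rfl
      by_cases h : x = j <;> simp_all [twistLast]
  induction l generalizing x n ε e with
  | nil => exact IsReduced.cons_powWord ho _
  | cons y l ih =>
    have hn : n < L := hL n ε ⟨[], y :: l, by simp⟩
    have hyl : IsReduced (y :: l) := hl.infix ⟨x.toList ++ List.replicate n (i, ε), [], by simp⟩
    have hL' : ∀ k δ, List.replicate k (i, δ) <:+: l → k < L := fun k δ h =>
      hL k δ (h.trans ⟨List.replicate n (i, ε) ++ [y], [], by simp⟩)
    have hxy : n = 0 → ∀ z ∈ x, z.1 = y.1 → z.2 = y.2 := by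
      rintro rfl z hz
      rw [Option.mem_def] at hz
      subst hz
      exact (List.isChain_cons_cons.1 hl).1
    have hne : (if ε = true then (n : ℤ) else -n) = 0 → n = 0 := by cases ε <;> simp
    have hlt : -(L : ℤ) < (if ε = true then (n : ℤ) else -n) ∧
        (if ε = true then (n : ℤ) else -n) < L := by
      cases ε <;> simp only [if_true, Bool.false_eq_true, if_false] <;> omega
    have ih₀ : ∀ y e, y.1 ≠ i → IsReduced (y :: l) → e = twistShift j L (some y) →
        IsReduced (twistLast j (some y) :: twistWord i j L e l) := fun y e hy hyl he => by
      have hy' : ∀ z ∈ some y, z.1 ≠ i := by simpa using hy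
      refine ih (some y) 0 true e (by simpa using he) hy' (by simpa using hyl)
        (by simpa using hL') ?_
      by_cases h : y.1 = j <;> simp_all [twistLast]
    obtain ⟨y, s⟩ := y
    rw [twistWord]
    by_cases h₁ : y = i
    · rw [if_pos h₁]
      subst h₁
      rcases n.eq_zero_or_pos with rfl | hn'
      · refine ih x 1 s _ ?_ hx (by simpa using hl) (by simpa using hL) ho
        rw [he]
        cases s <;> cases ε <;> simp
      · obtain ⟨m, rfl⟩ := Nat.exists_eq_add_one_of_ne_zero hn'.ne'
        obtain rfl : ε = s := (List.isChain_cons_cons.1 (hl.infix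
          ⟨x.toList ++ List.replicate m (y, ε), l, by simp [List.replicate_succ']⟩ :
            IsReduced [(y, ε), (y, s)])).1 rfl
        have e' : List.replicate (m + 1) (y, ε) ++ (y, ε) :: l =
            List.replicate (m + 1 + 1) (y, ε) ++ l := by
          rw [List.replicate_succ' (n := m + 1)]; simp
        rw [e'] at hl hL
        refine ih x (m + 1 + 1) ε _ ?_ hx hl hL ho
        rw [he]
        cases ε <;> simp <;> ring
    · rw [if_neg h₁]
      generalize (if ε = true then (n : ℤ) else -n) = k at he hne hlt
      by_cases h₂ : y = j
      · subst h₂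
        rw [if_pos rfl]
        have h₃ := ih₀ (y, s)
        cases s
        · simp only [Bool.false_eq_true, if_false]
          refine IsReduced.cons_powWord_append ho (by simp) ?_ _ ?_
          · refine List.isChain_cons_cons.2 ⟨by simp, List.isChain_cons_cons.2 ⟨by simp, ?_⟩⟩
            simpa [twistLast, IsReduced] using h₃ (-L) h₁ hyl (by simp [twistShift])
          · rcases x with _ | ⟨x, t⟩
            · simp [twistLast]
            · by_cases hxj : x = y
              · subst hxj
                -- The next letter is `j⁻¹`. After `j⁻¹` the exponent is `-L` plus a run shorter
                -- than `L`, so nonzero; after `j` it vanishes only if `j j⁻¹` occurred in the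
                -- reduced word.
                cases t
                · simp [twistShift] at he
                  intro; omega
                · simp [twistShift] at he
                  intro h0
                  simpa using hxy (hne (by omega))
              · simp [twistLast, hxj]
        · simp only [if_true]
          refine IsReduced.cons_powWord_append ho (by simp) ?_ _ ?_
          · refine List.isChain_cons_cons.2 ⟨by simp, List.isChain_cons_cons.2 ⟨by simp, ?_⟩⟩
            simpa [twistLast, IsReduced] using h₃ 0 h₁ hyl (by simp [twistShift])
          · rcases x with _ | ⟨x, t⟩
            · simp [twistLast]
            · by_cases hxj : x = y
              · subst hxj
                -- The next letter is `j`. After `j⁻¹` the shifts `-L` and `L` cancel, and a zero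
                -- exponent would mean `j⁻¹ j`; after `j` the shift `L` outweighs the run.
                cases t
                · simp [twistShift] at he
                  intro h0
                  simpa using hxy (hne (by omega))
                · simp [twistShift] at he
                  intro; omega
              · simp [twistLast, hxj]
      · rw [if_neg h₂]
        refine IsReduced.cons_powWord_append ho (by simpa using h₁) ?_ _ ?_
        · simpa [twistLast, h₂] using ih₀ (y, s) 0 h₁ hyl (by simp [twistShift, h₂])
        · rcases x with _ | ⟨x, t⟩
          · simp [twistLast]
          · by_cases hxj : x = j
            · simp [twistLast, hxj]
            · simp only [twistShift, hxj, false_and, if_false] at he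
              simp only [twistLast, hxj, if_false]
              intro h0 hxy'
              exact hxy (hne (by omega)) _ rfl (by simpa using hxy')

end FreeGroup

/-! ### Bounds on runs, and letters without cancellation. -/

namespace FreeGroup

section Bounds

variable {α : Type*} [DecidableEq α] {i j : α} {M : ℕ}

theorem isReduced_twistWord (hij : i ≠ j) {L : ℕ} {l : List (α × Bool)} (hl : IsReduced l)
    (hL : ∀ k δ, List.replicate k (i, δ) <:+: l → k < L) : IsReduced (twistWord i j L 0 l) := by
  have := IsReduced.cons_twistWord hij l none 0 true 0 (by simp [twistShift]) (by simp)
    (by simpa using hl) (by simpa using hL)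
  exact this.infix ⟨[twistLast j none], [], by simp⟩

theorem weightedNorm_twist_eq (hij : i ≠ j) {L : ℕ} {w w' : Option α → ℝ}
    (h : ∀ x, x ≠ j → w (some x) = w' (some x))
    (hj : 2 * w none + w (some j) = 2 * w' none + w' (some j)) {l : List (α × Bool)}
    (hl : IsReduced l) (hL : ∀ k δ, List.replicate k (i, δ) <:+: l → k < L) :
    weightedNorm w (twist i j L (mk l)) = weightedNorm w' (twist i j L (mk l)) := by
  have e := mk_twistWord hij L 0 l
  rw [zpow_zero, one_mul] at e
  have hr := isReduced_twistWord hij hl hL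
  rw [← e, weightedNorm_mk_of_isReduced w hr, weightedNorm_mk_of_isReduced w' hr,
    wordWeight_twistWord L h hij hj]

/-- A run across the seam is a suffix run of `l` followed by a prefix run of `l`. -/
theorem le_of_replicate_infix_append_self {β : Type*} {x : β} {l : List β} {m : ℕ}
    (h : ∀ k, List.replicate k x <:+: l → k ≤ m) {k : ℕ} (hk : List.replicate k x <:+: l ++ l) :
    k ≤ 2 * m := by
  rcases List.infix_append_iff.1 hk with h' | h' | ⟨l₁, l₂, e, h₁, h₂⟩
  · linarith [h k h']
  · linarith [h k h']
  · have e₁ := List.eq_replicate_of_mem (a := x) (l := l₁) fun y hy =>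
      List.eq_of_mem_replicate (e ▸ List.mem_append_left _ hy)
    have e₂ := List.eq_replicate_of_mem (a := x) (l := l₂) fun y hy =>
      List.eq_of_mem_replicate (e ▸ List.mem_append_right _ hy)
    have hlen := congrArg List.length e
    rw [e₁] at h₁
    rw [e₂] at h₂
    have := h _ h₁.isInfix
    have := h _ h₂.isInfix
    simp at hlen
    omega

theorem toWord_mk_singleton_mul {z : α × Bool} {y : FreeGroup α}
    (h : y.toWord.head? ≠ some (z.1, !z.2)) : (mk [z] * y).toWord = z :: y.toWord := by
  rw [toWord_mul, toWord_mk, reduce_singleton]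
  refine IsReduced.reduce_eq ?_
  have := isReduced_toWord (x := y)
  revert this h
  generalize y.toWord = l
  intro h hl
  cases l with
  | nil => exact List.isChain_singleton _
  | cons t l =>
    refine List.isChain_cons_cons.2 ⟨fun e => ?_, hl⟩
    by_contra e'
    refine h ?_
    simp only [List.head?_cons, Option.some.injEq]
    exact Prod.ext e.symm (Bool.eq_not.2 (Ne.symm e'))

theorem weightedNorm_inv_mul_of_ne (w : α → ℝ) {z z' : α × Bool} (hz : z ≠ z') {x y : FreeGroup α}
    (hx : x.toWord.head? ≠ some (z.1, !z.2)) (hy : y.toWord.head? ≠ some (z'.1, !z'.2)) :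
    weightedNorm w ((mk [z] * x)⁻¹ * (mk [z'] * y)) =
      weightedNorm w (mk [z] * x) + weightedNorm w (mk [z'] * y) := by
  rw [weightedNorm_inv_mul, toWord_mk_singleton_mul hx, toWord_mk_singleton_mul hy]
  simp [longestCommonPrefix, hz]

/-- Of the four letters `i ^ ±1`, `c ^ ±1` at most two are excluded. The remaining two, put in front
of words beginning with `u` or `v`, separate them at `1`; this serves minimality. -/
theorem exists_letters_avoiding {i c : α} (hic : i ≠ c) (u v : Option (α × Bool)) :
    ∃ z z' : α × Bool, z ≠ z' ∧ (z.1 = i ∨ z.1 = c) ∧ (z'.1 = i ∨ z'.1 = c) ∧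
      (∀ x ∈ ({u, v} : Set (Option (α × Bool))), x ≠ some (z.1, !z.2)) ∧
      ∀ x ∈ ({u, v} : Set (Option (α × Bool))), x ≠ some (z'.1, !z'.2) := by
  let s : Finset (Option (α × Bool)) :=
    {some (i, true), some (i, false), some (c, true), some (c, false)}
  have hs : s.card = 4 := by simp [s, hic]
  have hc : 1 < (s \ {u, v}).card := by
    have h1 := Finset.le_card_sdiff {u, v} s
    have h2 := Finset.card_le_two (a := u) (b := v)
    omega
  obtain ⟨a, ha, b, hb, hab⟩ := Finset.one_lt_card.1 hc
  have key : ∀ a ∈ s \ {u, v}, ∃ z : α × Bool, a = some (z.1, !z.2) ∧ (z.1 = i ∨ z.1 = c) ∧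
      ∀ x ∈ ({u, v} : Set (Option (α × Bool))), x ≠ some (z.1, !z.2) := by
    intro a ha
    rw [Finset.mem_sdiff] at ha
    obtain ⟨⟨p, q⟩, rfl⟩ : ∃ p, a = some p := by
      have := ha.1
      simp only [s, Finset.mem_insert, Finset.mem_singleton] at this
      rcases this with h | h | h | h <;> exact ⟨_, h⟩
    refine ⟨(p, !q), by simp, ?_, ?_⟩
    · have := ha.1
      simp only [s, Finset.mem_insert, Finset.mem_singleton, Option.some.injEq,
        Prod.mk.injEq] at this
      tauto
    · rintro x hx rfl
      apply ha.2
      simpa using hx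
  obtain ⟨z, rfl, hz, hz'⟩ := key a ha
  obtain ⟨y, rfl, hy, hy'⟩ := key b hb
  exact ⟨z, y, fun e => hab (by rw [e]), hz, hy, hz', hy'⟩

end Bounds

end FreeGroup

open FreeGroup

/-! ### The stick trees and their translation lengths. -/

/-- Letter weights on the free group with an additional letter: `p` for the additional letter, `q`
for the letter `j`, and `1` for all others. -/
def stickWeight {α : Type*} [DecidableEq α] (j : α) (p q : ℝ) : Option α → ℝ
  | none => p
  | some x => if x = j then q else 1

section stickTree

variable {N : ℕ} (A : FreeGroupBasis (Fin N) (FreeGroup (Fin N)))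

/-- The length function on `F_N` obtained from a weighted word length through `twist`. -/
def stickNorm (i j : Fin N) (L : ℕ) (p q : ℝ) (g : FreeGroup (Fin N)) : ℝ :=
  weightedNorm (stickWeight j p q) (twist i j L (A.repr g))

theorem one_le_stickWeight {α : Type*} [DecidableEq α] {j : α} {p q : ℝ} (hp : 1 ≤ p) (hq : 1 ≤ q)
    (x : Option α) : 1 ≤ stickWeight j p q x := by
  rcases x with _ | x
  · exact hp
  · simp only [stickWeight]
    split_ifs
    exacts [hq, le_rfl]

variable {i j c : Fin N} (L : ℕ) {p q : ℝ}

theorem isZeroHyperbolic_stickNorm (hp : 1 ≤ p) (hq : 1 ≤ q) :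
    IsZeroHyperbolic (normDist (stickNorm A i j L p q)) := by
  have h := (isZeroHyperbolic_weightedNorm (w := stickWeight j p q) fun x =>
    zero_le_one.trans (one_le_stickWeight hp hq x)).comap fun g => twist i j L (A.repr g)
  convert h using 3
  simp [normDist, stickNorm]

theorem one_le_stickNorm_mul_self_sub (hij : i ≠ j) (hp : 1 ≤ p) (hq : 1 ≤ q)
    (g : FreeGroup (Fin N)) (hg : g ≠ 1) :
    1 ≤ stickNorm A i j L p q (g * g) - stickNorm A i j L p q g := by
  rw [stickNorm, stickNorm, _root_.map_mul, _root_.map_mul]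
  refine le_weightedNorm_mul_self_sub zero_le_one (one_le_stickWeight hp hq) fun h => hg ?_
  have := twist_injective hij L (h.trans (_root_.map_one _).symm)
  simpa using this

theorem exists_stickNorm_add (hij : i ≠ j) (hic : i ≠ c) (hcj : c ≠ j) (u v : FreeGroup (Fin N)) :
    ∃ g k, ∀ x ∈ ({u, v} : Set (FreeGroup (Fin N))), ∀ y ∈ ({u, v} : Set (FreeGroup (Fin N))),
      stickNorm A i j L p q ((g * x)⁻¹ * (k * y)) =
        stickNorm A i j L p q (g * x) + stickNorm A i j L p q (k * y) := by
  let φ : FreeGroup (Fin N) → FreeGroup (Option (Fin N)) := fun g => twist i j L (A.repr g)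
  -- Since `twist` alters only `j`, the separating letters `i ^ ±1` and `c ^ ±1` come from `F_N`.
  have hlift : ∀ z : Option (Fin N) × Bool, z.1 = some i ∨ z.1 = some c → ∃ g, φ g = mk [z] := by
    have hgen : ∀ x s, x ≠ j → ∃ g, φ g = mk [(some x, s)] := fun x s hx => by
      cases s
      · refine ⟨A.repr.symm (of x)⁻¹, ?_⟩
        simp only [φ, MulEquiv.apply_symm_apply, _root_.map_inv, twist_of_ne L hx]
        rfl
      · refine ⟨A.repr.symm (of x), ?_⟩
        simp only [φ, MulEquiv.apply_symm_apply, twist_of_ne L hx]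
        rfl
    rintro ⟨z, s⟩ (h | h) <;> obtain rfl : z = _ := h
    · exact hgen i s hij
    · exact hgen c s hcj
  obtain ⟨z, z', hne, hz, hz', hu, hv⟩ := exists_letters_avoiding
    (fun h => hic (Option.some.inj h)) (φ u).toWord.head? (φ v).toWord.head?
  obtain ⟨g, hg⟩ := hlift z hz
  obtain ⟨k, hk⟩ := hlift z' hz'
  refine ⟨g, k, fun x hx y hy => ?_⟩
  have hx' : (φ x).toWord.head? ≠ some (z.1, !z.2) := hu _ (by rcases hx with rfl | rfl <;> simp)
  have hy' : (φ y).toWord.head? ≠ some (z'.1, !z'.2) := hv _ (by rcases hy with rfl | rfl <;> simp)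
  have := weightedNorm_inv_mul_of_ne (stickWeight j p q) hne hx' hy'
  rw [← hg, ← hk] at this
  simpa [stickNorm, φ] using this

/-- The tree of `stickNorm`: the universal cover of a rose in which a stick of length `p` is
attached to a loop of length `q`. -/
noncomputable def stickTree (hij : i ≠ j) (hic : i ≠ c) (hcj : c ≠ j) (hp : 1 ≤ p) (hq : 1 ≤ q) :
    FreeGroupTree N :=
  FreeGroupTree.ofNorm (stickNorm A i j L p q) (isZeroHyperbolic_stickNorm A L hp hq) one_pos
    (one_le_stickNorm_mul_self_sub A L hij hp hq) (exists_stickNorm_add A L hij hic hcj)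

theorem translationLength_stickTree (hij : i ≠ j) (hic : i ≠ c) (hcj : c ≠ j) (hp : 1 ≤ p)
    (hq : 1 ≤ q) (g : FreeGroup (Fin N)) :
    (stickTree A L hij hic hcj hp hq).translationLength g =
      max 0 (stickNorm A i j L p q (g * g) - stickNorm A i j L p q g) :=
  FreeGroupTree.translationLength_ofNorm _ _ _ _ _ g

/-- The image is `s * j * s⁻¹`, so the value is `(2 * p + 2 * q) - (2 * p + q)`. -/
theorem translationLength_stickTree_loop (hij : i ≠ j) (hic : i ≠ c) (hcj : c ≠ j) (hp : 1 ≤ p)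
    (hq : 1 ≤ q) : (stickTree A L hij hic hcj hp hq).translationLength
      (A.repr.symm ((of i ^ L)⁻¹ * of j)) = q := by
  have h1 : twist i j L ((of i ^ L)⁻¹ * of j) =
      mk [(none, true), (some j, true), (none, false)] := by
    rw [_root_.map_mul, _root_.map_inv, map_pow, twist_of_ne L hij, twist_of_self, mk_cons_true,
      mk_cons_true, mk_cons_false, ← one_eq_mk]
    group
  have h2 : twist i j L ((of i ^ L)⁻¹ * of j) * twist i j L ((of i ^ L)⁻¹ * of j) =
      mk [(none, true), (some j, true), (some j, true), (none, false)] := by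
    rw [h1]
    simp only [mk_cons_true, mk_cons_false, ← one_eq_mk]
    group
  rw [translationLength_stickTree, stickNorm, stickNorm, _root_.map_mul, _root_.map_mul,
    MulEquiv.apply_symm_apply, h2, h1, weightedNorm_mk_of_isReduced, weightedNorm_mk_of_isReduced]
  · simp [stickWeight]
    linarith
  · simp [FreeGroup.IsReduced]
  · simp [FreeGroup.IsReduced]

theorem translationLength_stickTree_eq {p' q' : ℝ} (hij : i ≠ j) (hic : i ≠ c) (hcj : c ≠ j)
    (hp : 1 ≤ p) (hq : 1 ≤ q) (hp' : 1 ≤ p') (hq' : 1 ≤ q') (h : 2 * p + q = 2 * p' + q') {M : ℕ}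
    (σ : FreeGroup (Fin N))
    (hσ : ∀ k : ℤ, IsCyclicSubword (A.repr (A i ^ k)).toWord (cyclicWord A σ) → |k| ≤ (M : ℤ)) :
    (stickTree A (2 * M + 1) hij hic hcj hp hq).translationLength σ =
      (stickTree A (2 * M + 1) hij hic hcj hp' hq').translationLength σ := by
  set l := reduceCyclically (A.repr σ).toWord with hl
  have hcyc : IsCyclicallyReduced l := reduceCyclically.isCyclicallyReduced isReduced_toWord
  have hll : IsReduced (l ++ l) := by
    simpa [List.replicate_succ] using (hcyc.flatten_replicate 2).isReduced
  have hM : ∀ (k : ℕ) (δ : Bool), List.replicate k (i, δ) <:+: l → k ≤ M := fun k δ hk => by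
    cases δ
    · have := hσ (-k) ⟨l, rfl, by simpa [invRev] using hk⟩
      rw [abs_neg, Nat.abs_cast] at this
      exact_mod_cast this
    · have := hσ k ⟨l, rfl, by simpa using hk⟩
      rw [Nat.abs_cast] at this
      exact_mod_cast this
  obtain ⟨g, hg⟩ : ∃ g, σ = g * A.repr.symm (mk l) * g⁻¹ := by
    refine ⟨A.repr.symm (mk (reduceCyclically.conjugator (A.repr σ).toWord)), ?_⟩
    have := reduceCyclically.conj_conjugator_reduceCyclically (A.repr σ).toWord
    rw [← _root_.map_inv, ← _root_.map_mul, ← _root_.map_mul, inv_mk, mul_mk, mul_mk, hl, this,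
      mk_toWord, MulEquiv.symm_apply_apply]
  have hw : ∀ x, x ≠ j → stickWeight j p q (some x) = stickWeight j p' q' (some x) := fun x hx => by
    simp [stickWeight, hx]
  have hj : 2 * stickWeight j p q none + stickWeight j p q (some j) =
      2 * stickWeight j p' q' none + stickWeight j p' q' (some j) := by
    simpa [stickWeight] using h
  have e1 := weightedNorm_twist_eq hij (L := 2 * M + 1) hw hj hcyc.isReduced fun k δ hk => by
    have := hM k δ hk
    omega
  -- The translation length also involves the square, whose runs can reach `2 * M`; hence the choice
  -- `L = 2 * M + 1`.
  have e2 := weightedNorm_twist_eq hij (L := 2 * M + 1) hw hj hll fun k δ hk => by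
    have := le_of_replicate_infix_append_self (fun k => hM k δ) hk
    omega
  rw [hg, FreeGroupTree.translationLength_conj, FreeGroupTree.translationLength_conj,
    translationLength_stickTree, translationLength_stickTree]
  simp only [stickNorm, ← _root_.map_mul, MulEquiv.apply_symm_apply, mul_mk, e1, e2]

end stickTree

/-! ### Two trees that agree on `S`. -/

theorem mainTheorem6 (N : ℕ) (hN : 3 ≤ N) (S : Set (FreeGroup (Fin N))) (hS : PropertyW S) :
    ¬ SpectrallyRigid S := by
  obtain ⟨A, i, M, -, hM⟩ := hS
  intro hrigid
  obtain ⟨j, hj⟩ : ∃ j, j ∉ ({i} : Finset (Fin N)) := by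
    by_contra! h
    have := Finset.card_le_card fun x (_ : x ∈ Finset.univ) => h x
    simp at this
    omega
  obtain ⟨c, hc⟩ : ∃ c, c ∉ ({i, j} : Finset (Fin N)) := by
    by_contra! h
    have := (Finset.card_le_card fun x (_ : x ∈ Finset.univ) => h x).trans Finset.card_le_two
    simp at this
    omega
  simp only [Finset.mem_insert, Finset.mem_singleton, not_or] at hj hc
  have hij : i ≠ j := Ne.symm hj
  have hic : i ≠ c := Ne.symm hc.1
  -- Both choices give `2 * p + q = 5`, with `q = 3` and `q = 1`.
  let T₁ := stickTree A (2 * M + 1) (p := 1) (q := 3) hij hic hc.2 le_rfl (by norm_num)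
  let T₂ := stickTree A (2 * M + 1) (p := 2) (q := 1) hij hic hc.2 (by norm_num) le_rfl
  have h : (Quotient.mk _ T₁ : OuterSpace N) = Quotient.mk _ T₂ := hrigid _ _ fun σ hσ =>
    translationLength_stickTree_eq A hij hic hc.2 _ _ _ _ (by norm_num) σ (hM σ hσ)
  have := congrFun (congrArg OuterSpace.translationLength h)
    (A.repr.symm ((of i ^ (2 * M + 1))⁻¹ * of j))
  change T₁.translationLength _ = T₂.translationLength _ at this
  rw [translationLength_stickTree_loop, translationLength_stickTree_loop] at this
  norm_num at this
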